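/- **Corollary (reversal-bounded queue automata).** A (one-way, nondeterministic) queue automaton consists of finite sets $Q$ (states), $\Sigma$ (input alphabet), $\Gamma$ (queue alphabet), an initial state $q_0\in Q$, a set $F\subseteq Q$ of accepting states, and a finite transition relation. Depending on the current state, on an input letter that is read from left to right (or on no input letter, for a $\lambda$-move), and on the symbol at the front of the queue (or on the queue being empty), a transition changes the state and either leaves the queue unchanged, appends one symbol of $\Gamma$ at its rear, or removes the symbol at its front. A word is accepted if some computation that starts in $q_0$ with the empty queue reads the whole word and ends in a state of $F$; $L(M)\subseteq\Sigma^*$ is the set of words accepted by $M$. For $k\in\mathbb N$, $M$ is $k$-reversal-bounded if every accepting computation of $M$ makes at most $k$ switches between increasing and decreasing the size of the queue. A language $L\subseteq\Sigma^*$ is dense if every word of $\Sigma^*$ is an infix of some word of $L$. It is decidable, given a queue automaton $M$ and a number $k$ such that $M$ is $k$-reversal-bounded, whether $L(M)$ is dense. That is, there is a single algorithm that halts on every pair $(M,k)$ of a (finitely described) queue automaton and a number and that, whenever $M$ is $k$-reversal-bounded, correctly answers whether $L(M)$ is dense. -/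

import Mathlib

/-- Store instructions of a queue: leave it unchanged, add one symbol at the rear, or remove the
symbol at the front. -/
inductive QueueOp (G : Type) where
  | stay : QueueOp G
  | enq (g : G) : QueueOp G
  | deq : QueueOp G

namespace QueueOp

/-- Relabel the queue symbols. -/
def map {G H : Type} (f : G → H) : QueueOp G → QueueOp H
  | stay => stay
  | enq g => enq (f g)
  | deq => deq

/-- Effect on the size of the queue: `some true` = increasing, `some false` = decreasing,
`none` = unchanged. -/
def dir {G : Type} : QueueOp G → Option Bool
  | stay => none
  | enq _ => some true
  | deq => some false

/-- The effect of an instruction on the contents of the queue (front of the queue = head of the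
list); `deq` is undefined on the empty queue. -/
def apply {G : Type} : QueueOp G → List G → Option (List G)
  | stay, s => some s
  | enq g, s => some (s ++ [g])
  | deq, [] => none
  | deq, _ :: s => some s

/-- Used only to number the instructions. -/
def equivOption (G : Type) : QueueOp G ≃ Option (Option G) where
  toFun
    | stay => none
    | deq => some none
    | enq g => some (some g)
  invFun
    | none => stay
    | some none => deq
    | some (some g) => enq g
  left_inv o := by cases o <;> rfl
  right_inv o := by rcases o with _ | _ | g <;> rfl

instance {G : Type} [Primcodable G] : Primcodable (QueueOp G) :=
  Primcodable.ofEquiv (Option (Option G)) (equivOption G)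

end QueueOp

/-- The number of positions at which a sequence of directions changes. -/
def directionChanges : List Bool → ℕ
  | a :: b :: l => (if a = b then 0 else 1) + directionChanges (b :: l)
  | _ => 0

/-- The number of switches between increasing and decreasing the size of the queue in a sequence of
store instructions; instructions that leave the queue unchanged are ignored. -/
def queueReversals {G : Type} (ops : List (QueueOp G)) : ℕ :=
  directionChanges (ops.filterMap QueueOp.dir)

/-- A one-way nondeterministic queue automaton with state set `Q`, input alphabet `A` and queue
alphabet `G` (it is a machine in the usual sense when these three types are finite).
`trans q a f op q'`: in state `q`, reading `a` from the input (`none` = no input letter is read),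
with `f` at the front of the queue (`none` = the queue is empty), the machine may perform `op` on the
queue and go to state `q'`. -/
structure QueueAutomaton (Q A G : Type) where
  trans : Q → Option A → Option G → QueueOp G → Q → Prop
  start : Q
  accept : Set Q

namespace QueueAutomaton

variable {Q A G : Type}

/-- `M.Run q w s ops q' w' s'`: from state `q`, remaining input `w` and queue contents `s`, the
machine can reach state `q'`, remaining input `w'` and queue contents `s'`, performing successively
the store instructions `ops`, one for each move. -/
inductive Run (M : QueueAutomaton Q A G) :
    Q → List A → List G → List (QueueOp G) → Q → List A → List G → Prop
  | refl (q : Q) (w : List A) (s : List G) : Run M q w s [] q w s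
  | step {q q₁ q₂ : Q} {a : Option A} {w w₂ : List A} {s s₁ s₂ : List G}
      {op : QueueOp G} {ops : List (QueueOp G)}
      (ht : M.trans q a s.head? op q₁) (hs : op.apply s = some s₁)
      (hr : Run M q₁ w s₁ ops q₂ w₂ s₂) :
      Run M q (a.toList ++ w) s (op :: ops) q₂ w₂ s₂

/-- There is an accepting computation on the input `w` with store instructions `ops`: it starts in
the start state with empty queue and ends in an accepting state with the whole input read. -/
def AcceptsVia (M : QueueAutomaton Q A G) (w : List A) (ops : List (QueueOp G)) : Prop :=
  ∃ q ∈ M.accept, ∃ s : List G, M.Run M.start w [] ops q [] s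

/-- The accepted language. -/
def language (M : QueueAutomaton Q A G) : Language A :=
  {w | ∃ ops, M.AcceptsVia w ops}

/-- Every accepting computation makes at most `k` switches between increasing and decreasing the
size of the queue. -/
def IsReversalBounded (M : QueueAutomaton Q A G) (k : ℕ) : Prop :=
  ∀ w ops, M.AcceptsVia w ops → queueReversals ops ≤ k

end QueueAutomaton

/-- The set of infixes of the words of a language. -/
def Language.infixes {A : Type} (L : Language A) : Language A :=
  {y | ∃ w ∈ L, y <:+: w}

/-- A language is dense if every word is an infix of one of its words. -/
def Language.IsDense {A : Type} (L : Language A) : Prop :=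
  L.infixes = (Set.univ : Set (List A))

/-- A finite description of a queue automaton, as given to an algorithm: states are
`0, …, lastState`, input letters are the numbers below `inputSize`, queue symbols are the numbers
below `queueSize`, and the transitions and the accepting states are listed. -/
structure QueueAutomatonCode where
  lastState : ℕ
  inputSize : ℕ
  queueSize : ℕ
  transList : List (ℕ × Option ℕ × Option ℕ × QueueOp ℕ × ℕ)
  startState : ℕ
  acceptList : List ℕ

namespace QueueAutomatonCode

/-- Used only to number the descriptions. -/
def equivProd : QueueAutomatonCode ≃
    ℕ × ℕ × ℕ × List (ℕ × Option ℕ × Option ℕ × QueueOp ℕ × ℕ) × ℕ × List ℕ where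
  toFun c := (c.lastState, c.inputSize, c.queueSize, c.transList, c.startState, c.acceptList)
  invFun p := ⟨p.1, p.2.1, p.2.2.1, p.2.2.2.1, p.2.2.2.2.1, p.2.2.2.2.2⟩
  left_inv _ := rfl
  right_inv _ := rfl

instance : Primcodable QueueAutomatonCode :=
  Primcodable.ofEquiv _ equivProd

/-- The queue automaton that is described. Listed items that mention a number out of range are
void; a start state out of range is reduced modulo the number of states. -/
def toAutomaton (c : QueueAutomatonCode) :
    QueueAutomaton (Fin (c.lastState + 1)) (Fin c.inputSize) (Fin c.queueSize) where
  trans q a f op q' :=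
    (q.val, a.map Fin.val, f.map Fin.val, op.map Fin.val, q'.val) ∈ c.transList
  start := Fin.ofNat (c.lastState + 1) c.startState
  accept := {q | q.val ∈ c.acceptList}

/-- Every queue automaton with nonempty finite state set and finite alphabets, its states and
symbols being numbered, has a description. -/
theorem exists_toAutomaton_eq (n m g : ℕ)
    (M : QueueAutomaton (Fin (n + 1)) (Fin m) (Fin g)) :
    ∃ T F, toAutomaton ⟨n, m, g, T, M.start.val, F⟩ = M := by
  classical
  let e : Fin (n + 1) × Option (Fin m) × Option (Fin g) × QueueOp (Fin g) × Fin (n + 1) →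
      ℕ × Option ℕ × Option ℕ × QueueOp ℕ × ℕ := fun t =>
    (t.1.val, t.2.1.map Fin.val, t.2.2.1.map Fin.val, t.2.2.2.1.map Fin.val, t.2.2.2.2.val)
  have he : Function.Injective e := by
    rintro ⟨q, a, f, op, q'⟩ ⟨r, b, h, op', r'⟩ heq
    simp only [e, Prod.mk.injEq] at heq
    obtain ⟨h1, h2, h3, h4, h5⟩ := heq
    have h4' : op = op' := by
      cases op <;> cases op' <;> simp_all [QueueOp.map, Fin.ext_iff]
    rw [Fin.ext h1, Option.map_injective Fin.val_injective h2,
      Option.map_injective Fin.val_injective h3, h4', Fin.ext h5]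
  have : Finite (QueueOp (Fin g)) := Finite.of_equiv _ (QueueOp.equivOption (Fin g)).symm
  have hT := Set.toFinite {t : Fin (n + 1) × Option (Fin m) × Option (Fin g) × QueueOp (Fin g) ×
    Fin (n + 1) | M.trans t.1 t.2.1 t.2.2.1 t.2.2.2.1 t.2.2.2.2}
  have hF := Set.toFinite M.accept
  refine ⟨hT.toFinset.toList.map e, hF.toFinset.toList.map Fin.val, ?_⟩
  obtain ⟨tr, st, ac⟩ := M
  simp only [toAutomaton, QueueAutomaton.mk.injEq]
  refine ⟨?_, ?_, ?_⟩
  · funext q a f op q'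
    have := List.mem_map_of_injective he (a := (q, a, f, op, q')) (l := hT.toFinset.toList)
    simpa [e] using this
  · ext; simp
  · ext q
    simp [Fin.val_inj]

end QueueAutomatonCode

/-!
Density of the language of a reversal-bounded queue automaton is decided by a search whose size is
bounded by a function of the automaton and of the number `k` of reversals.

An accepting computation with at most `k` reversals consists of at most `k + 2` monotone phases.
Cutting the phases further, one obtains a computation on a queue of *blocks*, in which every phase
appends or removes one block as a whole, with at most `(k + 3) ^ 2` phases (`BlockRun`,
`AcceptsVia.exists_blockRun`). A block is handled at most twice: in the phase that appends it and in
the phase that removes it. All that matters about it is its first letter and the pairs of states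
that these phases can connect, which is one of finitely many types (`queueType`). The type is
compatible with concatenation, so every block can be replaced by any block of its type, in
particular by a short one. This has two consequences.

* Input words also have finitely many types (`inputType`), and a word read during one phase can be
  replaced by any word of the same type. A high power of `u` that is an infix of an accepted word
  contains a copy of `u` read during one phase. As every word has the type of a short word, the
  language is dense as soon as all words up to a certain length are infixes of accepted words
  (`isDense_of_short`).
* If the automaton accepts anything with at most `k` reversals, then it does so with a short queue,
  hence, as then only finitely many configurations are involved, within a bounded number of moves.
  Applied to the product of the automaton with a finite automaton that guesses the position of an
  infix `u` (`withInfix`), this bounds the search for an accepted word with infix `u`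
  (`AcceptsVia.exists_short_chain`).

The procedure `SearchDense` therefore lists all words up to the first bound and, for each of them,
all configurations of the product that can be reached within the second bound. It is primitive
recursive. It does not count reversals: what it finds are accepting computations in any case, and
reversal boundedness is needed only for the two bounds to suffice.
-/

/-! ### Composing and cutting computations -/

namespace QueueAutomaton

variable {Q A G : Type} {M : QueueAutomaton Q A G}

theorem Run.trans_append {q q' q'' : Q} {w w' : List A} {s s' s'' : List G}
    {ops ops' : List (QueueOp G)} (h : M.Run q w s ops q' [] s')
    (h' : M.Run q' w' s' ops' q'' [] s'') : M.Run q (w ++ w') s (ops ++ ops') q'' [] s'' := by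
  generalize hv : ([] : List A) = v at h
  induction h with
  | refl => subst hv; exact h'
  | step ht hs _ ih =>
    subst hv
    rw [List.append_assoc]
    exact .step ht hs (ih h' rfl)

theorem Run.exists_of_append {q q'' : Q} {w : List A} {s s'' : List G}
    {ops ops' : List (QueueOp G)} (h : M.Run q w s (ops ++ ops') q'' [] s'') :
    ∃ q' s' w₁ w₂, w = w₁ ++ w₂ ∧ M.Run q w₁ s ops q' [] s' ∧ M.Run q' w₂ s' ops' q'' [] s'' := by
  induction ops generalizing q w s with
  | nil => exact ⟨q, s, [], w, rfl, .refl .., h⟩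
  | cons op ops ih =>
    cases h with
    | step ht hs hr =>
      obtain ⟨q', s', w₁, w₂, rfl, h₁, h₂⟩ := ih hr
      exact ⟨q', s', _, w₂, (List.append_assoc ..).symm, .step ht hs h₁, h₂⟩

/-! ### Monotone phases of a computation -/

/-- The symbol visible at the front at the beginning of a phase with parameter `h` that handles the
word `v`: an increasing phase sees the old front `h`; a decreasing phase sees the first letter of
the word `v` to be removed or, if there is none, the symbol `h` behind it. -/
def frontBefore : Bool → Option G → List G → Option G
  | true, h, _ => h
  | false, h, v => v.head?.or h

/-- The parameter with which a phase continues after it has handled the word `v`. -/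
def frontAfter : Bool → Option G → List G → Option G
  | true, h, v => h.or v.head?
  | false, h, _ => h

/-- The instruction by which a phase handles one symbol: append it in an increasing phase, remove
it in a decreasing one. -/
def phaseOp : Bool → G → QueueOp G
  | true, g => .enq g
  | false, _ => .deq

/-- `M.Phase b p h w v q`: by moves that never decrease (`b = true`) or never increase (`b = false`)
the queue, the machine can go from state `p` to state `q`, reading `w`, and appending the word `v`
to a queue with front `h`, respectively removing `v` from a queue `v ++ s` where `s` has front `h`.
-/ inductive Phase (M : QueueAutomaton Q A G) (b : Bool) :
    Q → Option G → List A → List G → Q → Prop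
  | nil (p : Q) (h : Option G) : Phase M b p h [] [] p
  | stay {p r q : Q} {h : Option G} {a : Option A} {w : List A} {v : List G}
      (ht : M.trans p a (frontBefore b h v) .stay r) (hr : Phase M b r h w v q) :
      Phase M b p h (a.toList ++ w) v q
  | move {p r q : Q} {h : Option G} {a : Option A} {g : G} {w : List A} {v : List G}
      (ht : M.trans p a (frontBefore b h (g :: v)) (phaseOp b g) r)
      (hr : Phase M b r (frontAfter b h [g]) w v q) :
      Phase M b p h (a.toList ++ w) (g :: v) q

theorem frontAfter_nil (b : Bool) (h : Option G) : frontAfter b h [] = h := by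
  cases b <;> simp [frontAfter]

theorem frontBefore_append (b : Bool) (h : Option G) (v v' : List G) :
    frontBefore b h (v ++ v') = frontBefore b (frontBefore b h v') v := by
  cases b <;> simp [frontBefore, List.head?_append, Option.or_assoc]

theorem frontAfter_cons (b : Bool) (h : Option G) (g : G) (v : List G) :
    frontAfter b h (g :: v) = frontAfter b (frontAfter b h [g]) v := by
  cases b <;> simp [frontAfter]

theorem frontAfter_frontBefore (b : Bool) (h : Option G) (g : G) (v : List G) :
    frontAfter b (frontBefore b h v) [g] = frontBefore b (frontAfter b h [g]) v := by
  cases b <;> simp [frontAfter, frontBefore]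

theorem frontBefore_congr (b : Bool) (h : Option G) {v v' : List G} (e : v.head? = v'.head?) :
    frontBefore b h v = frontBefore b h v' := by
  cases b <;> simp [frontBefore, e]

theorem frontAfter_congr (b : Bool) (h : Option G) {v v' : List G} (e : v.head? = v'.head?) :
    frontAfter b h v = frontAfter b h v' := by
  cases b <;> simp [frontAfter, e]

theorem Phase.append {b : Bool} {p r q : Q} {h : Option G} {w w' : List A} {v v' : List G}
    (h₁ : M.Phase b p (frontBefore b h v') w v r)
    (h₂ : M.Phase b r (frontAfter b h v) w' v' q) : M.Phase b p h (w ++ w') (v ++ v') q := by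
  generalize hk : frontBefore b h v' = k at h₁
  induction h₁ generalizing h with
  | nil => rwa [frontAfter_nil] at h₂
  | stay ht _ ih =>
    subst hk
    rw [List.append_assoc]
    exact .stay (by rwa [frontBefore_append]) (ih h₂ rfl)
  | move ht _ ih =>
    subst hk
    rw [frontAfter_cons] at h₂
    rw [List.append_assoc]
    refine .move ?_ (ih h₂ (frontAfter_frontBefore ..).symm)
    exact (frontBefore_append b h (_ :: _) v').symm ▸ ht

theorem Phase.exists_of_append_left {b : Bool} {p q : Q} {h : Option G} {w w' : List A}
    {v : List G} (h₁ : M.Phase b p h (w ++ w') v q) :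
    ∃ r v₁ v₂, v = v₁ ++ v₂ ∧ M.Phase b p (frontBefore b h v₂) w v₁ r ∧
      M.Phase b r (frontAfter b h v₁) w' v₂ q := by
  generalize hu : w ++ w' = u at h₁
  induction h₁ generalizing w with
  | nil p h =>
    obtain ⟨rfl, rfl⟩ := List.append_eq_nil_iff.1 hu
    exact ⟨p, [], [], rfl, .nil .., .nil ..⟩
  | @stay p r q h a u v ht hr ih =>
    rcases w with _ | ⟨x, w⟩
    · obtain rfl : w' = _ := hu
      exact ⟨p, [], v, rfl, .nil .., by rw [frontAfter_nil]; exact .stay ht hr⟩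
    · obtain ⟨w₀, hw₀, hu₀⟩ : ∃ w₀, x :: w = a.toList ++ w₀ ∧ w₀ ++ w' = u := by
        cases a with
        | none => exact ⟨x :: w, rfl, hu⟩
        | some a => simp at hu; exact ⟨w, by simp [hu.1], hu.2⟩
      obtain ⟨r', v₁, v₂, rfl, k₁, k₂⟩ := ih hu₀
      rw [hw₀]
      exact ⟨r', v₁, v₂, rfl, .stay (by rwa [← frontBefore_append]) k₁, k₂⟩
  | @move p r q h a g u v ht hr ih =>
    rcases w with _ | ⟨x, w⟩
    · obtain rfl : w' = _ := hu
      exact ⟨p, [], g :: v, rfl, .nil .., by rw [frontAfter_nil]; exact .move ht hr⟩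
    · obtain ⟨w₀, hw₀, hu₀⟩ : ∃ w₀, x :: w = a.toList ++ w₀ ∧ w₀ ++ w' = u := by
        cases a with
        | none => exact ⟨x :: w, rfl, hu⟩
        | some a => simp at hu; exact ⟨w, by simp [hu.1], hu.2⟩
      obtain ⟨r', v₁, v₂, rfl, k₁, k₂⟩ := ih hu₀
      rw [hw₀]
      refine ⟨r', g :: v₁, v₂, rfl, .move (r := r) ?_ ?_, ?_⟩
      · rwa [← frontBefore_append]
      · rwa [frontAfter_frontBefore]
      · rwa [frontAfter_cons]

theorem Phase.exists_of_append_right {b : Bool} {p q : Q} {h : Option G} {w : List A}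
    {v v' : List G} (h₁ : M.Phase b p h w (v ++ v') q) :
    ∃ r w₁ w₂, w = w₁ ++ w₂ ∧ M.Phase b p (frontBefore b h v') w₁ v r ∧
      M.Phase b r (frontAfter b h v) w₂ v' q := by
  generalize hu : v ++ v' = u at h₁
  induction h₁ generalizing v with
  | nil p h =>
    obtain ⟨rfl, rfl⟩ := List.append_eq_nil_iff.1 hu
    exact ⟨p, [], [], rfl, .nil .., .nil ..⟩
  | @stay p r q h a w u ht hr ih =>
    obtain ⟨r', w₁, w₂, rfl, k₁, k₂⟩ := ih hu
    subst hu
    exact ⟨r', _, w₂, (List.append_assoc ..).symm, .stay (by rwa [← frontBefore_append]) k₁, k₂⟩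
  | @move p r q h a g w u ht hr ih =>
    rcases v with _ | ⟨x, v⟩
    · obtain rfl : v' = _ := hu
      exact ⟨p, [], _, rfl, .nil .., by rw [frontAfter_nil]; exact .move ht hr⟩
    · obtain ⟨rfl, rfl⟩ : x = g ∧ v ++ v' = u := by simpa using hu
      obtain ⟨r', w₁, w₂, rfl, k₁, k₂⟩ := ih rfl
      refine ⟨r', _, w₂, (List.append_assoc ..).symm, .move (r := r) ?_ ?_, ?_⟩
      · rwa [← frontBefore_append]
      · rwa [frontAfter_frontBefore]
      · rwa [frontAfter_cons]

/-- The instructions of `ops` do not change the size of the queue in the direction opposite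
to `b`. -/
def IsMonotone (b : Bool) (ops : List (QueueOp G)) : Prop :=
  ∀ op ∈ ops, op.dir ≠ some !b

theorem Run.exists_increasing {q q' : Q} {w : List A} {s s' : List G} {ops : List (QueueOp G)}
    (h : M.Run q w s ops q' [] s') (ho : IsMonotone true ops) :
    ∃ v, s' = s ++ v ∧ M.Phase true q s.head? w v q' := by
  generalize hv : ([] : List A) = z at h
  induction h with
  | refl => subst hv; exact ⟨[], by simp, .nil ..⟩
  | @step q q₁ q₂ a w w₂ s s₁ s₂ op ops ht hs hr ih =>
    subst hv
    obtain ⟨v, rfl, hv⟩ := ih (fun o h => ho o (.tail _ h)) rfl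
    cases op with
    | stay =>
      obtain rfl : s = s₁ := by simpa [QueueOp.apply] using hs
      exact ⟨v, rfl, .stay ht hv⟩
    | enq g =>
      obtain rfl : s ++ [g] = s₁ := by simpa [QueueOp.apply] using hs
      refine ⟨g :: v, by simp, .move ht ?_⟩
      simpa [frontAfter, List.head?_append] using hv
    | deq => exact absurd rfl (ho .deq (.head _))

theorem Run.exists_decreasing {q q' : Q} {w : List A} {s s' : List G} {ops : List (QueueOp G)}
    (h : M.Run q w s ops q' [] s') (ho : IsMonotone false ops) :
    ∃ v, s = v ++ s' ∧ M.Phase false q s'.head? w v q' := by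
  generalize hv : ([] : List A) = z at h
  induction h with
  | refl => subst hv; exact ⟨[], by simp, .nil ..⟩
  | @step q q₁ q₂ a w w₂ s s₁ s₂ op ops ht hs hr ih =>
    subst hv
    obtain ⟨v, rfl, hv⟩ := ih (fun o h => ho o (.tail _ h)) rfl
    cases op with
    | stay =>
      obtain rfl : s = _ := by simpa [QueueOp.apply] using hs
      refine ⟨v, rfl, .stay ?_ hv⟩
      simpa [frontBefore, List.head?_append] using ht
    | enq g => exact absurd rfl (ho (.enq g) (.head _))
    | deq =>
      rcases s with _ | ⟨g, s⟩
      · simp [QueueOp.apply] at hs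
      · obtain rfl : s = _ := by simpa [QueueOp.apply] using hs
        exact ⟨g :: v, rfl, .move ht hv⟩

theorem Phase.run_increasing {p q : Q} {h : Option G} {w : List A} {v s : List G}
    (hp : M.Phase true p h w v q) (hs : s.head? = h) : ∃ ops, M.Run p w s ops q [] (s ++ v) := by
  induction hp generalizing s with
  | nil => exact ⟨[], by simpa using .refl ..⟩
  | stay ht _ ih =>
    obtain ⟨ops, ho⟩ := ih hs
    subst hs
    exact ⟨_, .step ht rfl ho⟩
  | @move p r q h a g w v ht _ ih =>
    obtain ⟨ops, ho⟩ := ih (s := s ++ [g]) (by simp [List.head?_append, hs, frontAfter])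
    subst hs
    rw [List.append_assoc] at ho
    exact ⟨_, .step ht rfl ho⟩

theorem Phase.run_decreasing {p q : Q} {h : Option G} {w : List A} {v s : List G}
    (hp : M.Phase false p h w v q) (hs : s.head? = h) : ∃ ops, M.Run p w (v ++ s) ops q [] s := by
  induction hp generalizing s with
  | nil => exact ⟨[], by simpa using .refl ..⟩
  | stay ht _ ih =>
    obtain ⟨ops, ho⟩ := ih hs
    subst hs
    exact ⟨_, .step (op := .stay) (by rwa [List.head?_append]) rfl ho⟩
  | @move p r q h a g w v ht _ ih =>
    obtain ⟨ops, ho⟩ := ih hs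
    exact ⟨_, .step (op := .deq) (by simpa [frontBefore, phaseOp] using ht) rfl ho⟩

end QueueAutomaton

/-! ### Finite types of queue words and of input words -/

/-- If a map from words to a finite set is compatible with appending words on the right, then each
of its values is taken at a short word. -/
theorem exists_short_of_rightCongruence {A T : Type} [Finite T] (f : List A → T)
    (hf : ∀ x y z, f x = f y → f (x ++ z) = f (y ++ z)) (w : List A) :
    ∃ u : List A, u.length ≤ Nat.card T ∧ f u = f w := by
  induction hn : w.length using Nat.strong_induction_on generalizing w with
  | _ n ih =>
    subst hn
    by_cases hw : w.length ≤ Nat.card T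
    · exact ⟨w, hw, rfl⟩
    have : ¬ Function.Injective fun i : Fin (w.length + 1) => f (w.take i) := fun hi => by
      have := Nat.card_le_card_of_injective _ hi
      simp only [Nat.card_eq_fintype_card, Fintype.card_fin] at this
      omega
    obtain ⟨i, j, hlt, he⟩ : ∃ i j : Fin (w.length + 1), i < j ∧ f (w.take i) = f (w.take j) := by
      simp only [Function.Injective, not_forall] at this
      obtain ⟨i, j, he, hne⟩ := this
      rcases lt_or_gt_of_ne hne with h | h
      exacts [⟨i, j, h, he⟩, ⟨j, i, h, he.symm⟩]
    have h₁ := hf _ _ (w.drop j) he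
    rw [List.take_append_drop] at h₁
    obtain ⟨u, hu, hu'⟩ := ih _ (by simp; omega) (w.take i ++ w.drop j) rfl
    exact ⟨u, hu, hu'.trans h₁⟩

namespace QueueAutomaton

variable {Q A G : Type} (M : QueueAutomaton Q A G)

/-- The types of words over the queue alphabet: a first letter, if any, and a set of phases, each
given by its direction, first state, front parameter and last state. -/
abbrev QueueType (Q G : Type) : Type := Option G × Set (Bool × Q × Option G × Q)

/-- What matters of a word `v` for appending it to a queue and removing it in one phase each: its
first letter, and the states that can be connected by a phase handling `v`. -/
def queueType (v : List G) : QueueType Q G :=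
  (v.head?, {x | ∃ w, M.Phase x.1 x.2.1 x.2.2.1 w v x.2.2.2})

/-- The types of input words: sets of phases, each given by its direction, first state, front
parameter, type of the word handled and last state. -/
abbrev InputType (Q G : Type) : Type := Set (Bool × Q × Option G × QueueType Q G × Q)

/-- What matters of an input word `u` that is read during one phase. -/
def inputType (u : List A) : InputType Q G :=
  {x | ∃ v, M.queueType v = x.2.2.2.1 ∧ M.Phase x.1 x.2.1 x.2.2.1 u v x.2.2.2.2}

variable {M}

theorem head?_eq_of_queueType_eq {v v' : List G} (h : M.queueType v = M.queueType v') :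
    v.head? = v'.head? :=
  congrArg Prod.fst h

theorem Phase.exists_of_queueType_eq {v v' : List G} (h : M.queueType v = M.queueType v')
    {b : Bool} {p q : Q} {f : Option G} {w : List A} (hp : M.Phase b p f w v q) :
    ∃ w', M.Phase b p f w' v' q :=
  (Set.ext_iff.1 (congrArg Prod.snd h) (b, p, f, q)).1 ⟨w, hp⟩

theorem queueType_append_left (x : List G) {v v' : List G}
    (h : M.queueType v = M.queueType v') : M.queueType (x ++ v) = M.queueType (x ++ v') := by
  have key : ∀ {v v' : List G}, M.queueType v = M.queueType v' →
      (M.queueType (x ++ v)).2 ⊆ (M.queueType (x ++ v')).2 := by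
    rintro v v' h ⟨b, p, f, q⟩ ⟨w, hw⟩
    obtain ⟨r, w₁, w₂, rfl, h₁, h₂⟩ := hw.exists_of_append_right
    obtain ⟨w', h₂'⟩ := h₂.exists_of_queueType_eq h
    rw [frontBefore_congr _ _ (head?_eq_of_queueType_eq h)] at h₁
    exact ⟨_, h₁.append h₂'⟩
  refine Prod.ext ?_ (Set.Subset.antisymm (key h) (key h.symm))
  simp [queueType, List.head?_append, head?_eq_of_queueType_eq h]

theorem queueType_append_right (x : List G) {v v' : List G}
    (h : M.queueType v = M.queueType v') : M.queueType (v ++ x) = M.queueType (v' ++ x) := by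
  have key : ∀ {v v' : List G}, M.queueType v = M.queueType v' →
      (M.queueType (v ++ x)).2 ⊆ (M.queueType (v' ++ x)).2 := by
    rintro v v' h ⟨b, p, f, q⟩ ⟨w, hw⟩
    obtain ⟨r, w₁, w₂, rfl, h₁, h₂⟩ := hw.exists_of_append_right
    obtain ⟨w', h₁'⟩ := h₁.exists_of_queueType_eq h
    rw [frontAfter_congr _ _ (head?_eq_of_queueType_eq h)] at h₂
    exact ⟨_, h₁'.append h₂⟩
  refine Prod.ext ?_ (Set.Subset.antisymm (key h) (key h.symm))
  simp [queueType, List.head?_append, head?_eq_of_queueType_eq h]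

/-- An infix of the input of a phase can be replaced by a word of the same type, at the cost of
replacing the word that is handled by one of the same type. -/
theorem Phase.replace_infix {u u' : List A} (h : M.inputType u = M.inputType u') {b : Bool}
    {p q : Q} {f : Option G} {x y : List A} {v : List G}
    (hp : M.Phase b p f (x ++ u ++ y) v q) :
    ∃ v', M.queueType v' = M.queueType v ∧ M.Phase b p f (x ++ u' ++ y) v' q := by
  obtain ⟨r, v₁₂, v₃, rfl, h₁₂, h₃⟩ := hp.exists_of_append_left
  obtain ⟨r', v₁, v₂, rfl, h₁, h₂⟩ := h₁₂.exists_of_append_left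
  obtain ⟨v₂', ht, h₂'⟩ :=
    (Set.ext_iff.1 h (b, r', _, M.queueType v₂, r)).1 ⟨v₂, rfl, h₂⟩
  have ht' := queueType_append_left v₁ ht
  refine ⟨v₁ ++ v₂' ++ v₃, queueType_append_right v₃ ht', ?_⟩
  refine Phase.append (Phase.append ?_ h₂') ?_
  · rwa [frontBefore_congr _ _ (head?_eq_of_queueType_eq ht)]
  · rwa [frontAfter_congr _ _ (head?_eq_of_queueType_eq ht')]

theorem inputType_append_right (z : List A) {u u' : List A} (h : M.inputType u = M.inputType u') :
    M.inputType (u ++ z) = M.inputType (u' ++ z) := by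
  have key : ∀ {u u' : List A}, M.inputType u = M.inputType u' →
      M.inputType (u ++ z) ⊆ M.inputType (u' ++ z) := by
    rintro u u' h ⟨b, p, f, t, q⟩ ⟨v, hv, hp⟩
    obtain ⟨v', hv', hp'⟩ := Phase.replace_infix (x := []) h hp
    exact ⟨v', hv'.trans hv, hp'⟩
  exact Set.Subset.antisymm (key h) (key h.symm)

/-! ### Computations on a queue of blocks -/

/-- `M.BlockRun p cs ws`: an accepting computation from state `p` with queue contents `cs.flatten`,
composed of phases each of which appends one block as a whole to the list of blocks `cs` or removes
its first block as a whole. The words read in the phases are listed by `ws`. -/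
inductive BlockRun (M : QueueAutomaton Q A G) : Q → List (List G) → List (List A) → Prop
  | done {q : Q} (hq : q ∈ M.accept) (cs : List (List G)) : BlockRun M q cs []
  | push {p r : Q} {cs : List (List G)} {w : List A} {ws : List (List A)} {v : List G}
      (hp : M.Phase true p cs.flatten.head? w v r) (hr : BlockRun M r (cs ++ [v]) ws) :
      BlockRun M p cs (w :: ws)
  | pop {p r : Q} {cs : List (List G)} {w : List A} {ws : List (List A)} {v : List G}
      (hp : M.Phase false p cs.flatten.head? w v r) (hr : BlockRun M r cs ws) :
      BlockRun M p (v :: cs) (w :: ws)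

theorem BlockRun.exists_run {p : Q} {cs : List (List G)} {ws : List (List A)}
    (h : M.BlockRun p cs ws) :
    ∃ ops, ∃ q ∈ M.accept, ∃ s, M.Run p ws.flatten cs.flatten ops q [] s := by
  induction h with
  | done hq cs => exact ⟨[], _, hq, _, .refl ..⟩
  | push hp _ ih =>
    obtain ⟨ops, q, hq, s, hs⟩ := ih
    obtain ⟨ops', ho⟩ := hp.run_increasing rfl
    exact ⟨_, q, hq, s, ho.trans_append (by simpa using hs)⟩
  | pop hp _ ih =>
    obtain ⟨ops, q, hq, s, hs⟩ := ih
    obtain ⟨ops', ho⟩ := hp.run_decreasing rfl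
    exact ⟨_, q, hq, s, ho.trans_append hs⟩

/-- Waiting blocks can be cut, at the cost of one more phase: the phase that removes such a block,
if there is one, is cut in two. -/
theorem BlockRun.split_block {p : Q} {l r : List (List G)} {a b : List G} {ws : List (List A)}
    (h : M.BlockRun p (l ++ (a ++ b) :: r) ws) :
    ∃ ws', M.BlockRun p (l ++ a :: b :: r) ws' ∧ ws'.flatten = ws.flatten ∧
      ws'.length ≤ ws.length + 1 := by
  generalize hc : l ++ (a ++ b) :: r = cs at h
  induction h generalizing l r with
  | done hq => exact ⟨[], .done hq _, rfl, by simp⟩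
  | @push _ _ cs w ws v hp _ ih =>
    subst hc
    obtain ⟨ws', h', hf, hl⟩ := ih (l := l) (r := r ++ [v]) (by simp)
    refine ⟨w :: ws', .push (v := v) (by simpa using hp) (by simpa using h'), by simp [hf],
      by simpa using hl⟩
  | @pop _ _ cs w ws v hp hr ih =>
    rcases l with _ | ⟨c, l⟩
    · obtain ⟨rfl, rfl⟩ : a ++ b = v ∧ r = cs := by simpa using hc
      obtain ⟨q, w₁, w₂, rfl, h₁, h₂⟩ := hp.exists_of_append_right
      refine ⟨w₁ :: w₂ :: ws, .pop ?_ (.pop h₂ hr), by simp, by simp⟩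
      simpa [frontBefore, List.head?_append] using h₁
    · obtain ⟨rfl, rfl⟩ : c = v ∧ l ++ (a ++ b) :: r = cs := by simpa using hc
      obtain ⟨ws', h', hf, hl⟩ := ih rfl
      exact ⟨w :: ws', .pop (by simpa using hp) h', by simp [hf], by simpa using hl⟩

/-- A phase that appends several blocks can be cut into phases that append one block each. -/
theorem BlockRun.push_blocks {p r : Q} {cs cs' : List (List G)} {c : List G} {w : List A}
    {ws : List (List A)} (hp : M.Phase true p cs.flatten.head? w (c :: cs').flatten r)
    (h : M.BlockRun r (cs ++ c :: cs') ws) :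
    ∃ ws', M.BlockRun p cs ws' ∧ ws'.flatten = w ++ ws.flatten ∧
      ws'.length = ws.length + (c :: cs').length := by
  induction cs' generalizing p cs c w with
  | nil => exact ⟨w :: ws, .push (by simpa using hp) h, by simp, by simp⟩
  | cons c' cs' ih =>
    rw [List.flatten_cons] at hp
    obtain ⟨q, w₁, w₂, rfl, h₁, h₂⟩ := hp.exists_of_append_right
    obtain ⟨ws', h', hf, hl⟩ := ih (p := q) (cs := cs ++ [c]) (c := c') (w := w₂)
      (by simpa [frontAfter, List.head?_append] using h₂) (by simpa using h)
    exact ⟨w₁ :: ws', .push h₁ h', by simp [hf], by simp [hl]; omega⟩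

theorem exists_split_of_flatten_eq_append {c : List G} {cs : List (List G)} {s v : List G}
    (h : (c :: cs).flatten = s ++ v) :
    ∃ l a b r, c :: cs = l ++ (a ++ b) :: r ∧ l.flatten ++ a = s ∧ b ++ r.flatten = v := by
  induction cs generalizing c s with
  | nil => exact ⟨[], s, v, [], by simpa using h, by simp, by simp⟩
  | cons c' cs ih =>
    rw [List.flatten_cons, List.append_eq_append_iff] at h
    obtain ⟨s', rfl, h'⟩ | ⟨b, rfl, rfl⟩ := h
    · obtain ⟨l, a, b, r, h₁, h₂, h₃⟩ := ih h'
      exact ⟨c :: l, a, b, r, by simp [h₁], by simp [← h₂], h₃⟩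
    · exact ⟨[], s, b, c' :: cs, by simp, by simp, rfl⟩

/-- A computation composed of `bs.length` monotone phases is a computation on a queue of blocks,
with a number of blocks and of block moves that depends on `bs.length` only. -/
theorem BlockRun.of_run {q q' : Q} {w : List A} {s s' : List G} (bs : List (List (QueueOp G)))
    (hm : ∀ ops ∈ bs, ∃ b, IsMonotone b ops) (hq : q' ∈ M.accept)
    (h : M.Run q w s bs.flatten q' [] s') :
    ∃ cs ws, cs ≠ [] ∧ ws ≠ [] ∧ cs.flatten = s ∧ ws.flatten = w ∧ M.BlockRun q cs ws ∧
      cs.length ≤ bs.length + 1 ∧ ws.length ≤ (bs.length + 1) ^ 2 := by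
  induction bs generalizing q w s with
  | nil =>
    cases h
    exact ⟨[s'], [[]], by simp, by simp, by simp, by simp, .push (.nil ..) (.done hq _),
      by simp, by simp⟩
  | cons ops bs ih =>
    obtain ⟨r, s₁, w₁, w₂, rfl, h₁, h₂⟩ := Run.exists_of_append h
    obtain ⟨cs, ws, hcs, hws, rfl, rfl, hb, hcl, hwl⟩ := ih (fun o ho => hm o (.tail _ ho)) h₂
    obtain ⟨b, hb'⟩ := hm ops (.head _)
    cases b with
    | false =>
      obtain ⟨v, rfl, hp⟩ := h₁.exists_decreasing hb'
      exact ⟨v :: cs, w₁ :: ws, by simp, by simp, by simp, by simp, .pop hp hb, by simpa,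
        by simp only [List.length_cons]; nlinarith⟩
    | true =>
      obtain ⟨v, he, hp⟩ := h₁.exists_increasing hb'
      obtain ⟨c, cs, rfl⟩ := List.exists_cons_of_ne_nil hcs
      -- The end of the old queue contents may fall inside a block of the later computation.
      obtain ⟨l, a, b, r', hc, rfl, rfl⟩ := exists_split_of_flatten_eq_append he
      rw [hc] at hb hcl
      obtain ⟨ws', hs, hf, hl⟩ := hb.split_block
      have hf' : (l ++ [a]).flatten = l.flatten ++ a := by simp
      obtain ⟨ws'', hs', hf'', hl'⟩ := BlockRun.push_blocks (cs := l ++ [a]) (c := b) (cs' := r')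
        (by rw [hf']; exact hp) (by simpa using hs)
      refine ⟨l ++ [a], ws'', by simp, ?_, hf', by rw [hf'', hf], hs', ?_, ?_⟩
      · rintro rfl; simp at hl'
      · simp at hcl ⊢; omega
      · simp only [List.length_cons, List.length_append] at hcl hl' ⊢
        nlinarith

/-- A sequence of instructions is cut into monotone phases whose number is bounded by the number of
direction changes; the first phase, possibly empty, may be given either direction. -/
theorem exists_monotone_phases (b : Bool) (ops : List (QueueOp G)) :
    ∃ o bs, ops = List.flatten (o :: bs) ∧ IsMonotone b o ∧ (∀ o ∈ bs, ∃ b, IsMonotone b o) ∧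
      bs.length ≤ directionChanges (b :: ops.filterMap QueueOp.dir) := by
  induction ops generalizing b with
  | nil => exact ⟨[], [], rfl, by simp [IsMonotone], by simp, by simp⟩
  | cons op ops ih =>
    by_cases hd : op.dir = some !b
    · obtain ⟨o, bs, rfl, h₁, h₂, h₃⟩ := ih (!b)
      refine ⟨[], (op :: o) :: bs, by simp, by simp [IsMonotone], ?_, ?_⟩
      · rintro o' (_ | ⟨_, ho⟩)
        · refine ⟨!b, ?_⟩
          rintro x (_ | ⟨_, hx⟩)
          · simp [hd]
          · exact h₁ x hx
        · exact h₂ _ ho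
      · rw [List.filterMap_cons_some hd, directionChanges]
        simp at h₃ ⊢
        omega
    · obtain ⟨o, bs, rfl, h₁, h₂, h₃⟩ := ih b
      refine ⟨op :: o, bs, by simp, ?_, h₂, ?_⟩
      · rintro x (_ | ⟨_, hx⟩)
        · exact hd
        · exact h₁ x hx
      · refine h₃.trans (le_of_eq ?_)
        rcases hx : op.dir with _ | d
        · rw [List.filterMap_cons_none hx]
        · obtain rfl : d = b := by
            rw [hx] at hd
            cases d <;> cases b <;> simp_all
          rw [List.filterMap_cons_some hx]
          simp [directionChanges]

theorem directionChanges_cons_le (b : Bool) (l : List Bool) :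
    directionChanges (b :: l) ≤ directionChanges l + 1 := by
  cases l with
  | nil => simp [directionChanges]
  | cons a l => rw [directionChanges]; split_ifs <;> omega

theorem AcceptsVia.exists_blockRun {w : List A} {ops : List (QueueOp G)} {k : ℕ}
    (h : M.AcceptsVia w ops) (hk : queueReversals ops ≤ k) :
    ∃ cs ws, ws ≠ [] ∧ cs.flatten = [] ∧ ws.flatten = w ∧ M.BlockRun M.start cs ws ∧
      cs.length ≤ k + 3 ∧ ws.length ≤ (k + 3) ^ 2 := by
  obtain ⟨q, hq, s, hr⟩ := h
  obtain ⟨o, bs, rfl, h₁, h₂, h₃⟩ := exists_monotone_phases true ops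
  have h₄ : (o :: bs).length ≤ k + 2 := by
    have := directionChanges_cons_le true ((o :: bs).flatten.filterMap QueueOp.dir)
    simp only [queueReversals, List.length_cons] at *
    omega
  obtain ⟨cs, ws, -, hws, hc, hw, hb, hcl, hwl⟩ := BlockRun.of_run (o :: bs)
    (by rintro o' (_ | ⟨_, h⟩); exacts [⟨_, h₁⟩, h₂ _ h]) hq hr
  exact ⟨cs, ws, hws, hc, hw, hb, by omega, hwl.trans (Nat.pow_le_pow_left (by omega) 2)⟩

end QueueAutomaton

/-! ### Replacing blocks -/

/-- If a power `u ^ n` is an infix of a product of at most `n` words, then `u` is an infix of one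
of the factors. -/
theorem exists_infix_of_replicate_infix {A : Type} {u : List A} {ws : List (List A)} {n : ℕ}
    (hws : ws ≠ []) (hn : ws.length ≤ n) (h : (List.replicate n u).flatten <:+: ws.flatten) :
    ∃ w ∈ ws, u <:+: w := by
  induction ws generalizing n with
  | nil => exact absurd rfl hws
  | cons w ws ih =>
    obtain ⟨n, rfl⟩ : ∃ m, n = m + 1 := ⟨n - 1, by simp at hn; omega⟩
    obtain ⟨x, y, h⟩ := h
    simp only [List.replicate_succ, List.flatten_cons, List.append_assoc] at h
    -- Compare the end of the first factor with the end of the first copy of `u`.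
    rw [← List.append_assoc, List.append_eq_append_iff] at h
    obtain ⟨z, hz, -⟩ | ⟨z, hz, hz'⟩ := h
    · exact ⟨w, .head _, x, z, hz.symm⟩
    · rcases eq_or_ne ws [] with rfl | hne
      · obtain rfl : z = [] := by simp at hz'; exact hz'.1
        exact ⟨w, .head _, x, [], by simpa using hz⟩
      · obtain ⟨w', hw', hi⟩ := ih hne (by simpa using hn) ⟨z, y, by simp [hz']⟩
        exact ⟨w', .tail _ hw', hi⟩

namespace QueueAutomaton

variable {Q A G : Type} {M : QueueAutomaton Q A G}

theorem head?_flatten_congr {cs cs' : List (List G)}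
    (h : List.Forall₂ (fun c c' => M.queueType c = M.queueType c') cs cs') :
    cs.flatten.head? = cs'.flatten.head? := by
  induction h with
  | nil => rfl
  | cons h _ ih => simp [List.head?_append, head?_eq_of_queueType_eq h, ih]

theorem BlockRun.replace_blocks {p : Q} {cs cs' : List (List G)} {ws : List (List A)}
    (h : M.BlockRun p cs ws)
    (hc : List.Forall₂ (fun c c' => M.queueType c = M.queueType c') cs cs') :
    ∃ ws', M.BlockRun p cs' ws' := by
  induction h generalizing cs' with
  | done hq => exact ⟨[], .done hq _⟩
  | @push _ _ cs w ws v hp _ ih =>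
    obtain ⟨ws', h'⟩ := ih (List.rel_append hc (.cons (Eq.refl (M.queueType v)) .nil))
    rw [head?_flatten_congr hc] at hp
    exact ⟨_, .push hp h'⟩
  | pop hp _ ih =>
    obtain _ | ⟨hv, hc⟩ := hc
    obtain ⟨ws', h'⟩ := ih hc
    rw [head?_flatten_congr hc] at hp
    obtain ⟨w', hp'⟩ := hp.exists_of_queueType_eq hv
    exact ⟨_, .pop hp' h'⟩

/-- In a computation on blocks, a word `u` that is read during one phase can be replaced by a word
of the same type. The block that is handled in this phase changes, but not its type. -/
theorem BlockRun.replace_infix {p : Q} {cs : List (List G)} {ws : List (List A)}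
    (h : M.BlockRun p cs ws) {u u' w : List A} (hu : M.inputType u = M.inputType u')
    (hw : w ∈ ws) (huw : u <:+: w) :
    ∃ cs' ws', List.Forall₂ (fun c c' => M.queueType c = M.queueType c') cs cs' ∧
      M.BlockRun p cs' ws' ∧ u' <:+: ws'.flatten := by
  have hrefl : ∀ cs : List (List G),
      List.Forall₂ (fun c c' => M.queueType c = M.queueType c') cs cs :=
    fun cs => List.forall₂_same.2 fun _ _ => rfl
  induction h with
  | done => cases hw
  | @push _ _ cs w₀ ws v hp hr ih =>
    obtain _ | ⟨_, hw⟩ := hw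
    · obtain ⟨x, y, rfl⟩ := huw
      obtain ⟨v', hv, hp'⟩ := hp.replace_infix hu
      obtain ⟨ws', hr'⟩ := hr.replace_blocks (List.rel_append (hrefl cs) (.cons hv.symm .nil))
      exact ⟨cs, _, hrefl cs, .push hp' hr', x, y ++ ws'.flatten, by simp⟩
    · obtain ⟨cs', ws', hc, hr', hi⟩ := ih hw
      obtain ⟨cs₁, cs₂, h₁, h₂, rfl⟩ : ∃ cs₁ cs₂, List.Forall₂ _ cs cs₁ ∧
          List.Forall₂ _ [v] cs₂ ∧ cs' = cs₁ ++ cs₂ :=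
        ⟨_, _, (List.forall₂_take_append _ _ _ hc.flip).flip,
          (List.forall₂_drop_append _ _ _ hc.flip).flip, (List.take_append_drop _ _).symm⟩
      obtain _ | ⟨hv, _ | _⟩ := h₂
      rw [head?_flatten_congr h₁] at hp
      obtain ⟨w', hp'⟩ := hp.exists_of_queueType_eq hv
      exact ⟨cs₁, _, h₁, .push hp' hr', by
        rw [List.flatten_cons]; exact hi.trans (List.suffix_append _ _).isInfix⟩
  | @pop _ _ cs w₀ ws v hp hr ih =>
    obtain _ | ⟨_, hw⟩ := hw
    · obtain ⟨x, y, rfl⟩ := huw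
      obtain ⟨v', hv, hp'⟩ := hp.replace_infix hu
      exact ⟨v' :: cs, _, .cons hv.symm (hrefl cs), .pop hp' hr, x, y ++ ws.flatten, by simp⟩
    · obtain ⟨cs', ws', hc, hr', hi⟩ := ih hw
      rw [head?_flatten_congr hc] at hp
      exact ⟨v :: cs', _, .cons rfl hc, .pop hp hr', by
        rw [List.flatten_cons]; exact hi.trans (List.suffix_append _ _).isInfix⟩

/-- A reversal-bounded queue automaton accepts a dense language as soon as all words up to a certain
length are infixes of accepted words. -/
theorem isDense_of_short [Finite Q] [Finite G] {k : ℕ} (hM : M.IsReversalBounded k)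
    (h : ∀ u : List A, u.length ≤ (k + 3) ^ 2 * Nat.card (InputType Q G) →
      u ∈ M.language.infixes) : M.language.IsDense := by
  refine Set.eq_univ_of_forall fun w => ?_
  obtain ⟨u, hu, hut⟩ :=
    exists_short_of_rightCongruence M.inputType (fun _ _ z h => inputType_append_right z h) w
  -- Among many consecutive copies of `u`, one is read during a single phase.
  obtain ⟨x, ⟨ops, hx⟩, hi⟩ := h (List.replicate ((k + 3) ^ 2) u).flatten (by
    simp only [List.length_flatten, List.map_replicate, List.sum_replicate, smul_eq_mul]
    exact Nat.mul_le_mul_left _ hu)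
  obtain ⟨cs, ws, hne, hcs, rfl, hb, -, hl⟩ := hx.exists_blockRun (hM _ _ hx)
  obtain ⟨w', hw', hi'⟩ := exists_infix_of_replicate_infix hne hl hi
  obtain ⟨cs', ws', hc, hb', hi''⟩ := hb.replace_infix hut hw' hi'
  obtain ⟨ops, q, hq, s, hr⟩ := hb'.exists_run
  have hcs' : cs'.flatten = [] := by
    rw [← List.head?_eq_none_iff, ← head?_flatten_congr hc, hcs]; rfl
  rw [hcs'] at hr
  exact ⟨_, ⟨ops, q, hq, s, hr⟩, hi''⟩

/-! ### Computations with short queues -/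

/-- One move between configurations, the input being ignored. -/
def Step (M : QueueAutomaton Q A G) (x y : Q × List G) : Prop :=
  ∃ a op, M.trans x.1 a x.2.head? op y.1 ∧ op.apply x.2 = some y.2

/-- One move between configurations with at most `L` symbols in the queue. -/
def BoundedStep (M : QueueAutomaton Q A G) (L : ℕ) (x y : Q × List G) : Prop :=
  M.Step x y ∧ x.2.length ≤ L ∧ y.2.length ≤ L

open Relation

theorem Phase.reflTransGen_increasing {L : ℕ} {p q : Q} {h : Option G} {w : List A} {v s : List G}
    (hp : M.Phase true p h w v q) (hs : s.head? = h) (hL : (s ++ v).length ≤ L) :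
    ReflTransGen (M.BoundedStep L) (p, s) (q, s ++ v) := by
  induction hp generalizing s with
  | nil => simpa using ReflTransGen.refl
  | stay ht _ ih =>
    refine .head ?_ (ih hs hL)
    subst hs
    simp at hL
    exact ⟨⟨_, _, ht, rfl⟩, by simp; omega, by simp; omega⟩
  | @move p r q h a g w v ht _ ih =>
    rw [List.append_cons] at hL ⊢
    refine .head ?_ (ih (by simp [List.head?_append, hs, frontAfter]) hL)
    subst hs
    simp at hL
    exact ⟨⟨_, _, ht, rfl⟩, by simp; omega, by simp; omega⟩

theorem Phase.reflTransGen_decreasing {L : ℕ} {p q : Q} {h : Option G} {w : List A} {v s : List G}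
    (hp : M.Phase false p h w v q) (hs : s.head? = h) (hL : (v ++ s).length ≤ L) :
    ReflTransGen (M.BoundedStep L) (p, v ++ s) (q, s) := by
  induction hp generalizing s with
  | nil => simpa using ReflTransGen.refl
  | @stay p r q h a w v ht _ ih =>
    refine .head (b := (r, v ++ s)) ⟨⟨a, .stay, ?_, rfl⟩, hL, hL⟩ (ih hs hL)
    subst hs
    simpa [List.head?_append, frontBefore] using ht
  | @move p r q h a g w v ht _ ih =>
    simp at hL
    refine .head (b := (r, v ++ s)) ⟨⟨a, .deq, ?_, rfl⟩, ?_, ?_⟩ (ih hs ?_)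
    · simpa [frontBefore, phaseOp] using ht
    all_goals simp; omega

/-- Blocks of the same types can be chosen short, and then the queue stays short. -/
theorem BlockRun.exists_bounded [Finite Q] [Finite G] {L : ℕ} {p : Q} {cs cs' : List (List G)}
    {ws : List (List A)} (h : M.BlockRun p cs ws)
    (hc : List.Forall₂ (fun c c' => M.queueType c = M.queueType c') cs cs')
    (hL : cs'.flatten.length + ws.length * Nat.card (QueueType Q G) ≤ L) :
    ∃ q ∈ M.accept, ∃ s, ReflTransGen (M.BoundedStep L) (p, cs'.flatten) (q, s) := by
  induction h generalizing cs' with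
  | done hq => exact ⟨_, hq, _, .refl⟩
  | @push _ _ cs w ws v hp _ ih =>
    obtain ⟨v', hl, hv⟩ :=
      exists_short_of_rightCongruence M.queueType (fun _ _ z h => queueType_append_right z h) v
    rw [List.length_cons, add_mul, one_mul] at hL
    obtain ⟨q, hq, s, hs⟩ := ih (List.rel_append hc (.cons hv.symm .nil))
      (by
      rw [List.flatten_append, List.length_append, List.flatten_singleton]; omega)
    rw [head?_flatten_congr hc] at hp
    obtain ⟨w', hp'⟩ := hp.exists_of_queueType_eq hv.symm
    refine ⟨q, hq, s, (hp'.reflTransGen_increasing rfl ?_).trans (by simpa using hs)⟩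
    rw [List.length_append]
    omega
  | pop hp _ ih =>
    obtain _ | @⟨_, c', _, cs', hv, hc⟩ := hc
    rw [List.length_cons, add_mul, List.flatten_cons, List.length_append] at hL
    obtain ⟨q, hq, s, hs⟩ := ih hc (by omega)
    rw [head?_flatten_congr hc] at hp
    obtain ⟨w', hp'⟩ := hp.exists_of_queueType_eq hv
    refine ⟨q, hq, s, (hp'.reflTransGen_decreasing rfl ?_).trans hs⟩
    rw [List.length_append]
    omega

/-- If a word is accepted with few reversals, then some word is accepted with a short queue. -/
theorem AcceptsVia.exists_bounded [Finite Q] [Finite G] {w : List A} {ops : List (QueueOp G)}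
    {k : ℕ} (h : M.AcceptsVia w ops) (hk : queueReversals ops ≤ k) :
    ∃ q ∈ M.accept, ∃ s, ReflTransGen
      (M.BoundedStep ((k + 3) ^ 2 * Nat.card (QueueType Q G))) (M.start, []) (q, s) := by
  obtain ⟨cs, ws, -, hcs, -, hb, -, hl⟩ := h.exists_blockRun hk
  have := hb.exists_bounded (List.forall₂_same.2 fun _ _ => rfl)
    (L := (k + 3) ^ 2 * Nat.card (QueueType Q G))
    (by
      rw [hcs, List.length_nil, zero_add]; exact Nat.mul_le_mul_right _ hl)
  rwa [hcs] at this

end QueueAutomaton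

/-- A path in a finite set can be made short by removing loops. -/
theorem exists_short_chain {X T : Type} [Finite T] {R : X → X → Prop} {S : Set X} {f : X → T}
    (hf : Set.InjOn f S) (hR : ∀ x y, R x y → y ∈ S) {x y : X} (hx : x ∈ S)
    (h : Relation.ReflTransGen R x y) :
    ∃ l : List X, (x :: l).IsChain R ∧ (x :: l).getLast (List.cons_ne_nil _ _) = y ∧
      l.length ≤ Nat.card T := by
  suffices ∃ l : List X, (x :: l).IsChain R ∧ (x :: l).getLast (List.cons_ne_nil _ _) = y ∧
      (x :: l).Nodup ∧ ∀ z ∈ x :: l, z ∈ S by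
    obtain ⟨l, h₁, h₂, h₃, h₄⟩ := this
    refine ⟨l, h₁, h₂, ?_⟩
    have := Fintype.ofFinite T
    have := (List.Nodup.map_on (fun a ha b hb => hf (h₄ a ha) (h₄ b hb)) h₃).length_le_card
    rw [← Nat.card_eq_fintype_card] at this
    simp only [List.length_map, List.length_cons] at this
    omega
  induction h using Relation.ReflTransGen.head_induction_on with
  | refl => exact ⟨[], by simp, rfl, by simp, by simpa⟩
  | @head a c hac _ ih =>
    obtain ⟨l, h₁, h₂, h₃, h₄⟩ := ih (hR _ _ hac)
    by_cases ha : a ∈ c :: l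
    · obtain ⟨l₁, l₂, he⟩ := List.append_of_mem ha
      simp only [he] at h₁ h₂ h₃ h₄
      exact ⟨l₂, h₁.right_of_append, by simpa using h₂, h₃.of_append_right,
        fun z hz => h₄ z (List.mem_append_right _ hz)⟩
    · exact ⟨c :: l, .cons_cons hac h₁, by simpa using h₂, List.nodup_cons.2 ⟨ha, h₃⟩,
        by rintro z (_ | ⟨_, hz⟩); exacts [hx, h₄ z hz]⟩

/-! ### Guessing the position of an infix -/

/-- The moves, on the letter `a` (`none` = no letter), of the nondeterministic finite automaton with
states `0, …, u.length` that goes from `0` to `u.length` on the words with infix `u`. -/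
def Track {A : Type} (u : List A) (i : ℕ) (a : Option A) (j : ℕ) : Prop :=
  (j = i ∧ (a = none ∨ i = 0 ∨ i = u.length)) ∨ (j = i + 1 ∧ i < u.length ∧ u[i]? = a)

/-- Iterated moves of the automaton for the infix `u`. -/
inductive TrackPath {A : Type} (u : List A) : ℕ → List A → ℕ → Prop
  | nil (i : ℕ) : TrackPath u i [] i
  | cons {i j l : ℕ} {a : A} {w : List A} (h : Track u i (some a) j) (hw : TrackPath u j w l) :
      TrackPath u i (a :: w) l

instance {A : Type} [DecidableEq A] (u : List A) (i : ℕ) (a : Option A) (j : ℕ) :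
    Decidable (Track u i a j) :=
  inferInstanceAs (Decidable (_ ∨ _))

theorem track_none {A : Type} {u : List A} {i j : ℕ} : Track u i none j ↔ j = i := by
  simp only [Track, true_or, and_true, List.getElem?_eq_none_iff]
  omega

theorem TrackPath.append {A : Type} {u w w' : List A} {i j l : ℕ} (h : TrackPath u i w j)
    (h' : TrackPath u j w' l) : TrackPath u i (w ++ w') l := by
  induction h with
  | nil => exact h'
  | cons ht _ ih => exact .cons ht (ih h')

theorem TrackPath.loop {A : Type} {u : List A} {i : ℕ} (hi : i = 0 ∨ i = u.length) (w : List A) :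
    TrackPath u i w i := by
  induction w with
  | nil => exact .nil _
  | cons a w ih => exact .cons (.inl ⟨rfl, .inr hi⟩) ih

theorem TrackPath.of_append {A : Type} (x y : List A) :
    TrackPath (x ++ y) x.length y (x ++ y).length := by
  induction y generalizing x with
  | nil => simpa using .nil _
  | cons a y ih =>
    refine .cons (j := x.length + 1) (.inr ⟨rfl, by simp, by simp⟩) ?_
    simpa using ih (x ++ [a])

/-- Beyond state `0`, the rest of `u` is read without interruption; in state `0`, letters may be
skipped first. -/
theorem TrackPath.infix {A : Type} {u w : List A} {i : ℕ} (h : TrackPath u i w u.length) :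
    u.drop i <:+: w ∧ (i ≠ 0 → u.drop i <+: w) := by
  generalize hl : u.length = l at h
  induction h with
  | nil => subst hl; simp
  | @cons i j l a w ht _ ih =>
    obtain ⟨h₁, h₂⟩ := ih hl
    rcases ht with ⟨rfl, ha | hj | hj⟩ | ⟨rfl, hi, hu⟩
    · simp at ha
    · exact ⟨h₁.trans (List.suffix_cons _ _).isInfix, fun h => absurd hj h⟩
    · simp [hj]
    · have : u.drop i <+: a :: w := by
        rw [List.getElem?_eq_getElem hi, Option.some_inj] at hu
        rw [List.drop_eq_getElem_cons hi, hu]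
        exact List.cons_prefix_cons.2 ⟨rfl, h₂ (by omega)⟩
      exact ⟨this.isInfix, fun _ => this⟩

theorem trackPath_of_infix {A : Type} {u w : List A} (h : u <:+: w) :
    TrackPath u 0 w u.length := by
  obtain ⟨x, y, rfl⟩ := h
  exact ((TrackPath.loop (.inl rfl) x).append (.of_append [] u)).append (.loop (.inr rfl) y)

namespace QueueAutomaton

variable {Q A G : Type} {M : QueueAutomaton Q A G}

/-- The product of a queue automaton with the finite automaton for the infix `u`. It accepts the
words with infix `u` that are accepted by `M`. -/
def withInfix (M : QueueAutomaton Q A G) (u : List A) :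
    QueueAutomaton (Q × Fin (u.length + 1)) A G where
  trans x a f op y := M.trans x.1 a f op y.1 ∧ Track u x.2 a y.2
  start := (M.start, 0)
  accept := {x | x.1 ∈ M.accept ∧ x.2.val = u.length}

theorem Run.withInfix {u w : List A} {q q' : Q} {s s' : List G} {ops : List (QueueOp G)}
    (h : M.Run q w s ops q' [] s') {i : Fin (u.length + 1)}
    (ht : TrackPath u i w u.length) :
    (M.withInfix u).Run (q, i) w s ops (q', Fin.last _) [] s' := by
  generalize hv : ([] : List A) = v at h
  induction h generalizing i with
  | refl q w s =>
    subst hv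
    have : i = Fin.last _ := by
      have : ∀ {i j : ℕ}, TrackPath u i [] j → i = j := by
        rintro _ _ ⟨⟩
        rfl
      exact Fin.ext (this ht)
    subst this
    exact .refl ..
  | @step q q₁ q₂ a w w₂ s s₁ s₂ op ops htr hs hr ih =>
    subst hv
    rcases a with _ | a
    · exact .step (a := none) (q₁ := (q₁, i)) ⟨htr, track_none.2 rfl⟩ hs (ih ht rfl)
    · obtain _ | @⟨_, j, _, _, _, hj, hw⟩ := ht
      have hj' : j < u.length + 1 := by
        have := i.2
        rcases hj with ⟨rfl, -⟩ | ⟨rfl, h, -⟩ <;> omega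
      exact .step (a := some a) (q₁ := (q₁, ⟨j, hj'⟩)) ⟨htr, hj⟩ hs (ih hw rfl)

theorem AcceptsVia.withInfix {u w : List A} {ops : List (QueueOp G)} (h : M.AcceptsVia w ops)
    (hu : u <:+: w) : (M.withInfix u).AcceptsVia w ops := by
  obtain ⟨q, hq, s, hr⟩ := h
  exact ⟨(q, Fin.last _), ⟨hq, rfl⟩, s, hr.withInfix (trackPath_of_infix hu)⟩

theorem exists_run_of_reflTransGen {u : List A} {x y : (Q × Fin (u.length + 1)) × List G}
    (h : Relation.ReflTransGen (M.withInfix u).Step x y) :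
    ∃ w ops, M.Run x.1.1 w x.2 ops y.1.1 [] y.2 ∧ TrackPath u x.1.2 w y.1.2 := by
  induction h using Relation.ReflTransGen.head_induction_on with
  | refl => exact ⟨[], [], .refl .., .nil _⟩
  | @head x z hxz _ ih =>
    obtain ⟨w, ops, hr, hw⟩ := ih
    obtain ⟨a, op, ⟨ht, ht'⟩, hs⟩ := hxz
    refine ⟨_, _, .step ht hs hr, ?_⟩
    cases a with
    | none => rw [← track_none.1 ht']; exact hw
    | some a => exact .cons ht' hw

theorem mem_infixes_of_reflTransGen {u : List A} {x : Q × Fin (u.length + 1)} {s : List G}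
    (hx : x ∈ (M.withInfix u).accept)
    (h : Relation.ReflTransGen (M.withInfix u).Step ((M.withInfix u).start, []) (x, s)) :
    u ∈ M.language.infixes := by
  obtain ⟨w, ops, hr, hw⟩ := exists_run_of_reflTransGen h
  have : TrackPath u 0 w u.length := hx.2 ▸ hw
  exact ⟨w, ⟨ops, x.1, hx.1, s, hr⟩, this.infix.1⟩

/-- A number of moves within which `M.withInfix u` can accept if it accepts with at most `k`
reversals, where `M` has `n` states and `g` queue symbols, and `l` is the length of `u`. -/
def searchBound (n g k l : ℕ) : ℕ :=
  n * (l + 1) * (g + 1) ^ ((k + 3) ^ 2 * ((g + 1) *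
    2 ^ (2 * (n * (l + 1) * ((g + 1) * (n * (l + 1)))))))

/-- Words up to this length decide density, for a queue automaton with `n` states, `g` queue
symbols and at most `k` reversals. -/
def infixBound (n g k : ℕ) : ℕ :=
  (k + 3) ^ 2 * 2 ^ (2 * (n * ((g + 1) * (((g + 1) * 2 ^ (2 * (n * ((g + 1) * n)))) * n))))

theorem card_queueType (n g : ℕ) {Q G : Type} [Finite Q] [Finite G] (hn : Nat.card Q = n)
    (hg : Nat.card G = g) :
    Nat.card (QueueType Q G) = (g + 1) * 2 ^ (2 * (n * ((g + 1) * n))) := by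
  classical
  have := Fintype.ofFinite Q
  have := Fintype.ofFinite G
  subst hn hg
  simp

theorem card_inputType (n g : ℕ) {Q G : Type} [Finite Q] [Finite G] (hn : Nat.card Q = n)
    (hg : Nat.card G = g) : Nat.card (InputType Q G) =
      2 ^ (2 * (n * ((g + 1) * (((g + 1) * 2 ^ (2 * (n * ((g + 1) * n)))) * n)))) := by
  classical
  have := Fintype.ofFinite Q
  have := Fintype.ofFinite G
  subst hn hg
  simp

/-- If `u` is an infix of a word that is accepted with few reversals, then `M.withInfix u` has a
short accepting computation. -/
theorem AcceptsVia.exists_short_chain [Finite Q] [Finite G] {u w : List A}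
    {ops : List (QueueOp G)} {k : ℕ} (h : M.AcceptsVia w ops) (hk : queueReversals ops ≤ k)
    (hu : u <:+: w) :
    ∃ l : List ((Q × Fin (u.length + 1)) × List G),
      (((M.withInfix u).start, []) :: l).IsChain (M.withInfix u).Step ∧
      ((((M.withInfix u).start, []) :: l).getLast (List.cons_ne_nil _ _)).1 ∈
        (M.withInfix u).accept ∧
      l.length ≤ searchBound (Nat.card Q) (Nat.card G) k u.length := by
  obtain ⟨q, hq, s, hs⟩ := (h.withInfix hu).exists_bounded hk
  rw [card_queueType (Nat.card Q * (u.length + 1)) _ (by simp) rfl] at hs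
  set L := (k + 3) ^ 2 * _ with hL
  obtain ⟨l, h₁, h₂, h₃⟩ := _root_.exists_short_chain (S := {x | x.2.length ≤ L})
    (T := (Q × Fin (u.length + 1)) × (Fin L → Option G))
    (f := fun x => (x.1, fun i => x.2[i.val]?))
    (by
      rintro ⟨x, s⟩ hs ⟨y, t⟩ ht he
      simp only [Prod.mk.injEq, funext_iff] at he
      change s.length ≤ L at hs
      change t.length ≤ L at ht
      obtain ⟨rfl, he⟩ := he
      refine Prod.ext rfl (List.ext_getElem? fun i => ?_)
      by_cases hi : i < L
      · exact he ⟨i, hi⟩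
      · rw [List.getElem?_eq_none (by dsimp; omega), List.getElem?_eq_none (by dsimp; omega)])
    (fun x y h => h.2.2) (by simp) hs
  refine ⟨l, h₁.imp fun _ _ h => h.1, by rwa [h₂], h₃.trans (le_of_eq ?_)⟩
  have := Fintype.ofFinite Q
  have := Fintype.ofFinite G
  simp [searchBound, hL]

end QueueAutomaton

/-! ### Searching the configurations -/

namespace QueueOp

/-- The symbol that is appended by an instruction, if any. -/
def symbol {G : Type} (op : QueueOp G) : Option G :=
  (equivOption G op).join

theorem apply_map {G H : Type} (f : G → H) (op : QueueOp G) (s : List G) :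
    (op.map f).apply (s.map f) = (op.apply s).map (List.map f) := by
  cases op with
  | stay => rfl
  | enq g => simp [map, apply]
  | deq => cases s <;> rfl

end QueueOp

namespace QueueAutomatonCode

/-- If the transition `t` is applicable in the configuration `x` (a state, a state of the automaton
for the infix `u`, the queue contents) and the infix automaton may go to state `j`, the resulting
configuration. -/
def move (c : QueueAutomatonCode) (u : List ℕ) (x : ℕ × ℕ × List ℕ)
    (t : ℕ × Option ℕ × Option ℕ × QueueOp ℕ × ℕ) (j : ℕ) : Option (ℕ × ℕ × List ℕ) :=
  if (t.1 = x.1 ∧ x.2.2.head? = t.2.2.1 ∧ t.2.2.2.2 < c.lastState + 1) ∧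
      (t.2.1 = none ∨ t.2.1.getD 0 < c.inputSize) ∧
      (t.2.2.2.1.symbol = none ∨ t.2.2.2.1.symbol.getD 0 < c.queueSize) ∧
      Track u x.2.1 t.2.1 j then
    (t.2.2.2.1.apply x.2.2).map fun s => (t.2.2.2.2, j, s)
  else none

/-- The configurations that can be reached from `x` by one move. -/
def successors (c : QueueAutomatonCode) (u : List ℕ) (x : ℕ × ℕ × List ℕ) :
    List (ℕ × ℕ × List ℕ) :=
  c.transList.flatMap fun t => (List.range (u.length + 1)).filterMap fun j => c.move u x t j

/-- The configurations that can be reached from the initial one by at most `n` moves. -/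
def reachable (c : QueueAutomatonCode) (u : List ℕ) : ℕ → List (ℕ × ℕ × List ℕ)
  | 0 => [(c.startState % (c.lastState + 1), 0, [])]
  | n + 1 => reachable c u n ++ (reachable c u n).flatMap (c.successors u)

/-- The word `u` is the infix of a word accepted within at most `n` moves. -/
def Finds (c : QueueAutomatonCode) (u : List ℕ) (n : ℕ) : Prop :=
  ∃ x ∈ c.reachable u n, x.1 ∈ c.acceptList ∧ x.2.1 = u.length

variable {c : QueueAutomatonCode} {u : List (Fin c.inputSize)}

/-- The numerical form of a configuration. -/
def code (x : (Fin (c.lastState + 1) × Fin (u.length + 1)) × List (Fin c.queueSize)) :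
    ℕ × ℕ × List ℕ :=
  (x.1.1.val, x.1.2.val, x.2.map Fin.val)

theorem track_map {m : ℕ} {u : List (Fin m)} {i j : ℕ} {a : Option (Fin m)} :
    Track (u.map Fin.val) i (a.map Fin.val) j ↔ Track u i a j := by
  simp [Track, (Option.map_injective Fin.val_injective).eq_iff]

theorem exists_option_map_val {m : ℕ} {a : Option ℕ} (h : a = none ∨ a.getD 0 < m) :
    ∃ a' : Option (Fin m), a'.map Fin.val = a := by
  rcases a with _ | a
  · exact ⟨none, rfl⟩
  · exact ⟨some ⟨a, by simpa using h⟩, rfl⟩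

theorem exists_queueOp_map_val {m : ℕ} {op : QueueOp ℕ}
    (h : op.symbol = none ∨ op.symbol.getD 0 < m) :
    ∃ op' : QueueOp (Fin m), op'.map Fin.val = op := by
  cases op with
  | stay => exact ⟨.stay, rfl⟩
  | deq => exact ⟨.deq, rfl⟩
  | enq g => exact ⟨.enq ⟨g, by simpa [QueueOp.symbol, QueueOp.equivOption] using h⟩, rfl⟩

theorem symbol_map_val {m : ℕ} (op : QueueOp (Fin m)) :
    (op.map Fin.val).symbol = none ∨ (op.map Fin.val).symbol.getD 0 < m := by
  cases op <;> simp [QueueOp.symbol, QueueOp.map, QueueOp.equivOption]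

theorem move_eq_some {u : List ℕ} {x z : ℕ × ℕ × List ℕ}
    {t : ℕ × Option ℕ × Option ℕ × QueueOp ℕ × ℕ} {j : ℕ} :
    c.move u x t j = some z ↔
      ((t.1 = x.1 ∧ x.2.2.head? = t.2.2.1 ∧ t.2.2.2.2 < c.lastState + 1) ∧
        (t.2.1 = none ∨ t.2.1.getD 0 < c.inputSize) ∧
        (t.2.2.2.1.symbol = none ∨ t.2.2.2.1.symbol.getD 0 < c.queueSize) ∧
        Track u x.2.1 t.2.1 j) ∧
      ∃ s, t.2.2.2.1.apply x.2.2 = some s ∧ (t.2.2.2.2, j, s) = z := by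
  rw [move, Option.ite_none_right_eq_some, Option.map_eq_some_iff]

theorem mem_successors_code
    {x : (Fin (c.lastState + 1) × Fin (u.length + 1)) × List (Fin c.queueSize)}
    {z : ℕ × ℕ × List ℕ} :
    z ∈ c.successors (u.map Fin.val) (code x) ↔
      ∃ y, (c.toAutomaton.withInfix u).Step x y ∧ code y = z := by
  obtain ⟨⟨q, i⟩, s⟩ := x
  simp only [successors, List.mem_flatMap, List.mem_filterMap, List.mem_range, List.length_map,
    move_eq_some, code]
  constructor
  · rintro ⟨⟨p, a, f, op, p'⟩, ht, j, hj, ⟨⟨rfl, rfl, hp'⟩, ha, hop, hT⟩, s', hs', rfl⟩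
    simp only at ha hop hT hs' hp'
    obtain ⟨a, rfl⟩ := exists_option_map_val ha
    obtain ⟨op, rfl⟩ := exists_queueOp_map_val hop
    rw [QueueOp.apply_map, Option.map_eq_some_iff] at hs'
    obtain ⟨s', hs', rfl⟩ := hs'
    refine ⟨((⟨p', hp'⟩, ⟨j, hj⟩), s'), ⟨a, op, ⟨?_, track_map.1 hT⟩, hs'⟩, rfl⟩
    simpa [toAutomaton] using ht
  · rintro ⟨⟨⟨q', j⟩, s'⟩, ⟨a, op, ⟨ht, hT⟩, hs'⟩, rfl⟩
    refine ⟨_, ht, j.val, j.2, ⟨⟨rfl, by simp, q'.2⟩, ?_, symbol_map_val op, track_map.2 hT⟩,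
      s'.map Fin.val, ?_, rfl⟩
    · cases a <;> simp
    · simp only at hs'
      simp [QueueOp.apply_map, hs']

theorem reachable_subset_succ (n : ℕ) (u : List ℕ) : c.reachable u n ⊆ c.reachable u (n + 1) :=
  List.subset_append_left _ _

theorem code_start : code ((c.toAutomaton.withInfix u).start, []) =
    (c.startState % (c.lastState + 1), 0, []) := by
  simp [code, QueueAutomaton.withInfix, toAutomaton]

theorem exists_of_mem_reachable {n : ℕ} {z : ℕ × ℕ × List ℕ}
    (hz : z ∈ c.reachable (u.map Fin.val) n) :
    ∃ y, Relation.ReflTransGen (c.toAutomaton.withInfix u).Step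
      ((c.toAutomaton.withInfix u).start, []) y ∧ code y = z := by
  induction n generalizing z with
  | zero => exact ⟨_, .refl, by rw [code_start]; simpa [reachable, eq_comm] using hz⟩
  | succ n ih =>
    rcases List.mem_append.1 hz with hz | hz
    · exact ih hz
    · obtain ⟨x, hx, hz⟩ := List.mem_flatMap.1 hz
      obtain ⟨y, hy, rfl⟩ := ih hx
      obtain ⟨y', hy', rfl⟩ := mem_successors_code.1 hz
      exact ⟨y', hy.tail hy', rfl⟩

theorem mem_reachable_of_isChain
    {x : (Fin (c.lastState + 1) × Fin (u.length + 1)) × List (Fin c.queueSize)}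
    {l : List ((Fin (c.lastState + 1) × Fin (u.length + 1)) × List (Fin c.queueSize))} {m n : ℕ}
    (h : (x :: l).IsChain (c.toAutomaton.withInfix u).Step) (hl : m + l.length ≤ n)
    (hx : code x ∈ c.reachable (u.map Fin.val) m) :
    code ((x :: l).getLast (List.cons_ne_nil _ _)) ∈ c.reachable (u.map Fin.val) n := by
  induction l generalizing x m with
  | nil =>
    induction n, (by simpa using hl : m ≤ n) using Nat.le_induction with
    | base => exact hx
    | succ n hmn ih => exact reachable_subset_succ _ _ (ih (by simpa))
  | cons y l ih =>
    rw [List.isChain_cons_cons] at h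
    rw [List.getLast_cons (List.cons_ne_nil _ _)]
    refine ih h.2 (m := m + 1) (by simp at hl; omega) ?_
    exact List.mem_append_right _
      (List.mem_flatMap.2 ⟨_, hx, mem_successors_code.2 ⟨y, h.1, rfl⟩⟩)

theorem mem_infixes_of_finds {n : ℕ} (h : c.Finds (u.map Fin.val) n) :
    u ∈ c.toAutomaton.language.infixes := by
  obtain ⟨z, hz, ha, hl⟩ := h
  obtain ⟨⟨x, s⟩, hs, rfl⟩ := exists_of_mem_reachable hz
  exact QueueAutomaton.mem_infixes_of_reflTransGen (x := x) ⟨ha, by simpa [code] using hl⟩ hs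

theorem finds_of_mem_infixes {k : ℕ} (hk : c.toAutomaton.IsReversalBounded k)
    (hu : u ∈ c.toAutomaton.language.infixes) :
    c.Finds (u.map Fin.val)
      (QueueAutomaton.searchBound (c.lastState + 1) c.queueSize k (u.map Fin.val).length) := by
  obtain ⟨w, ⟨ops, hw⟩, hi⟩ := hu
  obtain ⟨l, h₁, h₂, h₃⟩ := hw.exists_short_chain (hk _ _ hw) hi
  refine ⟨_, mem_reachable_of_isChain h₁ (m := 0) (by simpa using h₃) ?_, h₂.1, ?_⟩
  · rw [code_start]; exact List.mem_singleton_self _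
  · simpa [code] using h₂.2

/-- The words of length at most `n` over the letters `0, …, m - 1`. -/
def wordsUpTo (m : ℕ) : ℕ → List (List ℕ)
  | 0 => [[]]
  | n + 1 => [] :: (wordsUpTo m n).flatMap fun w => (List.range m).map fun a => a :: w

theorem mem_wordsUpTo {m n : ℕ} {w : List ℕ} :
    w ∈ wordsUpTo m n ↔ w.length ≤ n ∧ ∀ a ∈ w, a < m := by
  induction n generalizing w with
  | zero =>
    simp only [wordsUpTo, List.mem_singleton, Nat.le_zero, List.length_eq_zero_iff]
    exact ⟨by rintro rfl; simp, fun h => h.1⟩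
  | succ n ih =>
    cases w with
    | nil => simp [wordsUpTo]
    | cons a w => simp [wordsUpTo, ih]; tauto

/-- The decision procedure: whether each word up to a suitable length is found to be an infix by a
search up to a suitable depth. -/
def SearchDense (x : QueueAutomatonCode × ℕ) : Prop :=
  ∀ u ∈ wordsUpTo x.1.inputSize
      (QueueAutomaton.infixBound (x.1.lastState + 1) x.1.queueSize x.2),
    x.1.Finds u (QueueAutomaton.searchBound (x.1.lastState + 1) x.1.queueSize x.2 u.length)

theorem searchDense_iff {k : ℕ} (hk : c.toAutomaton.IsReversalBounded k) :
    SearchDense (c, k) ↔ c.toAutomaton.language.IsDense := by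
  constructor
  · intro h
    refine QueueAutomaton.isDense_of_short hk fun u hu => ?_
    rw [QueueAutomaton.card_inputType (c.lastState + 1) c.queueSize (by simp) (by simp)] at hu
    exact mem_infixes_of_finds (h _ (mem_wordsUpTo.2
      ⟨by simpa [QueueAutomaton.infixBound] using hu, by simp⟩))
  · intro h u hu
    obtain ⟨u, rfl⟩ : ∃ u' : List (Fin c.inputSize), u'.map Fin.val = u :=
      ⟨u.pmap Fin.mk (mem_wordsUpTo.1 hu).2, by simp [List.map_pmap]⟩
    exact finds_of_mem_infixes hk (Set.eq_univ_iff_forall.1 h u)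

end QueueAutomatonCode

/-! ### Computability of the decision procedure -/

theorem Primrec.nat_pow : Primrec₂ ((· ^ ·) : ℕ → ℕ → ℕ) :=
  Primrec₂.unpaired'.1 Nat.Primrec.pow

namespace QueueAutomaton

variable {α : Type} [Primcodable α]

theorem primrec_searchBound {n g k l : α → ℕ} (hn : Primrec n) (hg : Primrec g) (hk : Primrec k)
    (hl : Primrec l) : Primrec fun a => searchBound (n a) (g a) (k a) (l a) := by
  have hs : Primrec fun a => n a * (l a + 1) := Primrec.nat_mul.comp hn (Primrec.succ.comp hl)
  have hg' : Primrec fun a => g a + 1 := Primrec.succ.comp hg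
  have hk' : Primrec fun a => (k a + 3) ^ 2 :=
    Primrec.nat_pow.comp (Primrec.nat_add.comp hk (Primrec.const 3)) (Primrec.const 2)
  exact Primrec.nat_mul.comp hs (Primrec.nat_pow.comp hg' (Primrec.nat_mul.comp hk'
    (Primrec.nat_mul.comp hg' (Primrec.nat_pow.comp (Primrec.const 2)
      (Primrec.nat_mul.comp (Primrec.const 2)
        (Primrec.nat_mul.comp hs (Primrec.nat_mul.comp hg' hs)))))))

theorem primrec_infixBound {n g k : α → ℕ} (hn : Primrec n) (hg : Primrec g) (hk : Primrec k) :
    Primrec fun a => infixBound (n a) (g a) (k a) := by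
  have hg' : Primrec fun a => g a + 1 := Primrec.succ.comp hg
  have hk' : Primrec fun a => (k a + 3) ^ 2 :=
    Primrec.nat_pow.comp (Primrec.nat_add.comp hk (Primrec.const 3)) (Primrec.const 2)
  have hp : ∀ {f : α → ℕ}, Primrec f → Primrec fun a => 2 ^ (2 * (n a * f a)) := fun hf =>
    Primrec.nat_pow.comp (Primrec.const 2)
      (Primrec.nat_mul.comp (Primrec.const 2) (Primrec.nat_mul.comp hn hf))
  exact Primrec.nat_mul.comp hk' (hp (Primrec.nat_mul.comp hg' (Primrec.nat_mul.comp
    (Primrec.nat_mul.comp hg' (hp (Primrec.nat_mul.comp hg' hn))) hn)))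

end QueueAutomaton

namespace QueueOp

theorem primrec_symbol : Primrec (symbol : QueueOp ℕ → Option ℕ) :=
  (Primrec.option_bind Primrec.of_equiv (Primrec.snd (α := QueueOp ℕ)).to₂).of_eq fun op => by
    cases op <;> rfl

theorem primrec_apply : Primrec₂ (apply : QueueOp ℕ → List ℕ → Option (List ℕ)) := by
  have h : Primrec fun x : QueueOp ℕ × List ℕ => equivOption ℕ x.1 :=
    Primrec.of_equiv.comp Primrec.fst
  have hd : Primrec fun y : (QueueOp ℕ × List ℕ) × Option ℕ =>
      y.1.2.head?.map fun _ => y.1.2.tail :=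
    Primrec.option_map (Primrec.list_head?.comp (Primrec.snd.comp Primrec.fst))
      (Primrec.list_tail.comp (Primrec.snd.comp (Primrec.fst.comp Primrec.fst))).to₂
  have he : Primrec fun y : ((QueueOp ℕ × List ℕ) × Option ℕ) × ℕ => some (y.1.1.2 ++ [y.2]) :=
    Primrec.option_some.comp (Primrec.list_concat.comp
      (Primrec.snd.comp (Primrec.fst.comp Primrec.fst)) Primrec.snd)
  refine (Primrec.option_casesOn h (Primrec.option_some.comp Primrec.snd)
    (Primrec.option_casesOn Primrec.snd hd he.to₂).to₂).of_eq ?_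
  rintro ⟨op, s⟩
  cases op <;> cases s <;> rfl

end QueueOp

theorem primrecPred_track {α : Type} [Primcodable α] {u : α → List ℕ} {i j : α → ℕ}
    {a : α → Option ℕ} (hu : Primrec u) (hi : Primrec i) (ha : Primrec a) (hj : Primrec j) :
    PrimrecPred fun x => Track (u x) (i x) (a x) (j x) := by
  have hl := Primrec.list_length.comp hu
  exact ((Primrec.eq.comp hj hi).and ((Primrec.eq.comp ha (Primrec.const none)).or
    ((Primrec.eq.comp hi (Primrec.const 0)).or (Primrec.eq.comp hi hl)))).or
    ((Primrec.eq.comp hj (Primrec.succ.comp hi)).and ((Primrec.nat_lt.comp hi hl).and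
      (Primrec.eq.comp (Primrec.list_getElem?.comp hu hi) ha)))

namespace QueueAutomatonCode

theorem primrec_equivProd : Primrec equivProd := Primrec.of_equiv

theorem primrec_lastState : Primrec lastState :=
  (Primrec.fst.comp primrec_equivProd).of_eq fun _ => rfl

theorem primrec_inputSize : Primrec inputSize :=
  (Primrec.fst.comp (Primrec.snd.comp primrec_equivProd)).of_eq fun _ => rfl

theorem primrec_queueSize : Primrec queueSize :=
  (Primrec.fst.comp (Primrec.snd.comp (Primrec.snd.comp primrec_equivProd))).of_eq fun _ => rfl

theorem primrec_transList : Primrec transList :=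
  (Primrec.fst.comp (Primrec.snd.comp (Primrec.snd.comp
    (Primrec.snd.comp primrec_equivProd)))).of_eq fun _ => rfl

theorem primrec_startState : Primrec startState :=
  (Primrec.fst.comp (Primrec.snd.comp (Primrec.snd.comp (Primrec.snd.comp
    (Primrec.snd.comp primrec_equivProd))))).of_eq fun _ => rfl

theorem primrec_acceptList : Primrec acceptList :=
  (Primrec.snd.comp (Primrec.snd.comp (Primrec.snd.comp (Primrec.snd.comp
    (Primrec.snd.comp primrec_equivProd))))).of_eq fun _ => rfl

variable {α : Type} [Primcodable α]

theorem primrecPred_inRange {o : α → Option ℕ} {m : α → ℕ} (ho : Primrec o) (hm : Primrec m) :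
    PrimrecPred fun a => o a = none ∨ (o a).getD 0 < m a :=
  (Primrec.eq.comp ho (Primrec.const none)).or
    (Primrec.nat_lt.comp (Primrec.option_getD.comp ho (Primrec.const 0)) hm)

theorem primrec_move {c : α → QueueAutomatonCode} {u : α → List ℕ} {x : α → ℕ × ℕ × List ℕ}
    {t : α → ℕ × Option ℕ × Option ℕ × QueueOp ℕ × ℕ} {j : α → ℕ} (hc : Primrec c)
    (hu : Primrec u) (hx : Primrec x) (ht : Primrec t) (hj : Primrec j) :
    Primrec fun a => move (c a) (u a) (x a) (t a) (j a) := by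
  have hx₁ := Primrec.fst.comp hx
  have hx₂ := Primrec.fst.comp (Primrec.snd.comp hx)
  have hx₃ := Primrec.snd.comp (Primrec.snd.comp hx)
  have ht₁ := Primrec.fst.comp ht
  have ht₂ := Primrec.fst.comp (Primrec.snd.comp ht)
  have ht₃ := Primrec.fst.comp (Primrec.snd.comp (Primrec.snd.comp ht))
  have ht₄ := Primrec.fst.comp (Primrec.snd.comp (Primrec.snd.comp (Primrec.snd.comp ht)))
  have ht₅ := Primrec.snd.comp (Primrec.snd.comp (Primrec.snd.comp (Primrec.snd.comp ht)))
  have h₁ := (Primrec.eq.comp ht₁ hx₁).and ((Primrec.eq.comp (Primrec.list_head?.comp hx₃) ht₃).and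
    (Primrec.nat_lt.comp ht₅ (Primrec.succ.comp (primrec_lastState.comp hc))))
  have h₂ := primrecPred_inRange ht₂ (primrec_inputSize.comp hc)
  have h₃ := primrecPred_inRange (QueueOp.primrec_symbol.comp ht₄) (primrec_queueSize.comp hc)
  have h₄ := primrecPred_track hu hx₂ ht₂ hj
  have h₅ := Primrec.option_map (QueueOp.primrec_apply.comp ht₄ hx₃)
    (g := fun a s => ((t a).2.2.2.2, j a, s))
    (Primrec.pair (ht₅.comp Primrec.fst) (Primrec.pair (hj.comp Primrec.fst) Primrec.snd)).to₂
  exact Primrec.ite (h₁.and (h₂.and (h₃.and h₄))) h₅ (Primrec.const none)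

theorem primrec_successors {c : α → QueueAutomatonCode} {u : α → List ℕ}
    {x : α → ℕ × ℕ × List ℕ} (hc : Primrec c) (hu : Primrec u) (hx : Primrec x) :
    Primrec fun a => successors (c a) (u a) (x a) := by
  have hm : Primrec fun y : (α × ℕ × Option ℕ × Option ℕ × QueueOp ℕ × ℕ) × ℕ =>
      move (c y.1.1) (u y.1.1) (x y.1.1) y.1.2 y.2 :=
    have h := Primrec.fst.comp Primrec.fst
    primrec_move (hc.comp h) (hu.comp h) (hx.comp h) (Primrec.snd.comp Primrec.fst) Primrec.snd
  have hf : Primrec fun y : α × ℕ × Option ℕ × Option ℕ × QueueOp ℕ × ℕ =>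
      (List.range ((u y.1).length + 1)).filterMap fun j => move (c y.1) (u y.1) (x y.1) y.2 j :=
    Primrec.listFilterMap (Primrec.list_range.comp
      (Primrec.succ.comp (Primrec.list_length.comp (hu.comp Primrec.fst)))) hm.to₂
  exact Primrec.list_flatMap (primrec_transList.comp hc) hf.to₂

theorem primrec_reachable {c : α → QueueAutomatonCode} {u : α → List ℕ} {n : α → ℕ}
    (hc : Primrec c) (hu : Primrec u) (hn : Primrec n) :
    Primrec fun a => reachable (c a) (u a) (n a) := by
  have hs : Primrec fun a => [((c a).startState % ((c a).lastState + 1), 0, ([] : List ℕ))] :=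
    Primrec.list_cons.comp (Primrec.pair (Primrec.nat_mod.comp (primrec_startState.comp hc)
      (Primrec.succ.comp (primrec_lastState.comp hc))) (Primrec.const (0, [])))
      (Primrec.const [])
  have hf := Primrec.snd.comp (Primrec.snd (α := α) (β := ℕ × List (ℕ × ℕ × List ℕ)))
  have hr := Primrec.list_append.comp hf (Primrec.list_flatMap hf
    (primrec_successors (hc.comp (Primrec.fst.comp Primrec.fst))
      (hu.comp (Primrec.fst.comp Primrec.fst)) Primrec.snd).to₂)
  refine (Primrec.nat_rec' hn hs hr.to₂).of_eq fun a => ?_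
  induction n a with
  | zero => rfl
  | succ n ih => simp only [reachable, ← ih]

theorem primrecPred_exists_mem {β : Type} [Primcodable β] {l : α → List β} {R : β → α → Prop}
    (hl : Primrec l) (hR : PrimrecRel R) : PrimrecPred fun a => ∃ b ∈ l a, R b a :=
  hR.exists_mem_list.comp hl Primrec.id

theorem primrecPred_forall_mem {β : Type} [Primcodable β] {l : α → List β} {R : β → α → Prop}
    (hl : Primrec l) (hR : PrimrecRel R) : PrimrecPred fun a => ∀ b ∈ l a, R b a :=
  hR.forall_mem_list.comp hl Primrec.id

theorem primrecPred_finds {c : α → QueueAutomatonCode} {u : α → List ℕ} {n : α → ℕ}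
    (hc : Primrec c) (hu : Primrec u) (hn : Primrec n) :
    PrimrecPred fun a => Finds (c a) (u a) (n a) := by
  refine primrecPred_exists_mem (primrec_reachable hc hu hn)
    (R := fun x a => x.1 ∈ (c a).acceptList ∧ x.2.1 = (u a).length) ?_
  have h := primrecPred_exists_mem (α := (ℕ × ℕ × List ℕ) × α) (l := fun x => (c x.2).acceptList)
    (R := fun q x => q = x.1.1) (primrec_acceptList.comp (hc.comp Primrec.snd))
    (Primrec.eq.comp Primrec.fst (Primrec.fst.comp (Primrec.fst.comp Primrec.snd)))
  exact (h.of_eq fun x => by simp).and (Primrec.eq.comp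
    (Primrec.fst.comp (Primrec.snd.comp Primrec.fst))
    (Primrec.list_length.comp (hu.comp Primrec.snd)))

theorem primrec_wordsUpTo {m n : α → ℕ} (hm : Primrec m) (hn : Primrec n) :
    Primrec fun a => wordsUpTo (m a) (n a) := by
  have hr : Primrec fun x : α × ℕ × List (List ℕ) =>
      [] :: x.2.2.flatMap fun w => (List.range (m x.1)).map fun a => a :: w :=
    Primrec.list_cons.comp (Primrec.const []) (Primrec.list_flatMap
      (Primrec.snd.comp Primrec.snd) (Primrec.list_map
        (Primrec.list_range.comp (hm.comp (Primrec.fst.comp Primrec.fst)))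
        (Primrec.list_cons.comp Primrec.snd (Primrec.snd.comp Primrec.fst)).to₂).to₂)
  refine (Primrec.nat_rec' hn (Primrec.const [[]]) hr.to₂).of_eq fun a => ?_
  induction n a with
  | zero => rfl
  | succ n ih => simp only [wordsUpTo, ← ih]

theorem primrecPred_searchDense : PrimrecPred SearchDense := by
  have hc := Primrec.fst (α := QueueAutomatonCode) (β := ℕ)
  have hq := Primrec.succ.comp (primrec_lastState.comp hc)
  have hg := primrec_queueSize.comp hc
  have h := Primrec.snd (α := List ℕ) (β := QueueAutomatonCode × ℕ)
  exact primrecPred_forall_mem (primrec_wordsUpTo (primrec_inputSize.comp hc)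
    (QueueAutomaton.primrec_infixBound hq hg Primrec.snd))
    (primrecPred_finds (hc.comp h) Primrec.fst (QueueAutomaton.primrec_searchBound
      (hq.comp h) (hg.comp h) (Primrec.snd.comp h) (Primrec.list_length.comp Primrec.fst)))

end QueueAutomatonCode

theorem mainTheorem2 :
    ∃ D : QueueAutomatonCode × ℕ → Prop, ComputablePred D ∧
      ∀ (c : QueueAutomatonCode) (k : ℕ), c.toAutomaton.IsReversalBounded k →
        (D (c, k) ↔ c.toAutomaton.language.IsDense) :=
  ⟨QueueAutomatonCode.SearchDense, QueueAutomatonCode.primrecPred_searchDense.computablePred,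
    fun _ _ hk => QueueAutomatonCode.searchDense_iff hk⟩
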